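/- For an integer $m\ge 1$ and $k\ge 0$ put $\varphi_k=\cos\left(\frac{(2k+1)\pi}{m}\right)$ and $$S_k=\log(\varphi_k+1)-2\log\left[\sin\left(\tfrac13\arcsin\sqrt{\tfrac{\varphi_k+1}{2}}\right)\right]+\log\left[2\cos\left(\tfrac23\arcsin\sqrt{\tfrac{\varphi_k+1}{2}}\right)+1\right].$$ Then for every even integer $m\ge 2$ the following integral converges absolutely and $$\int_0^{\infty}\frac{x\log\left(x^{3m}+1\right)}{x^3+1}\,dx=\frac{\pi^2m}{9}-\frac{\pi m\sqrt3}{9}\log 2+\frac{2\pi\sqrt3}{9}\sum_{k=0}^{\frac{m-2}{2}}S_k,$$ and for every odd integer $m\ge 1$ the integral converges absolutely and $$\int_0^{\infty}\frac{x\log\left(x^{3m}+1\right)}{x^3+1}\,dx=\frac{\pi^2m}{9}+\frac{\pi\sqrt3}{3}\log 3-\frac{\pi(m-1)\sqrt3}{9}\log 2+\frac{2\pi\sqrt3}{9}\sum_{k=0}^{\frac{m-3}{2}}S_k,$$ where for $m=1$ the sum $\sum_{k=0}^{-1}$ is empty and equals $0$. -/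

import Mathlib

/-- `phi m k = cos ((2 k + 1) π / m)`. -/
noncomputable def phi (m k : ℕ) : ℝ := Real.cos ((2 * (k : ℝ) + 1) * Real.pi / (m : ℝ))

/-- The `k`-th summand of both closed forms, where `φ = phi m k`:
`log (φ + 1) - 2 log sin ((1/3) arcsin √((φ + 1)/2)) + log (2 cos ((2/3) arcsin √((φ + 1)/2)) + 1)`. -/
noncomputable def summand (m k : ℕ) : ℝ :=
  Real.log (phi m k + 1)
    - 2 * Real.log (Real.sin (1 / 3 * Real.arcsin (Real.sqrt ((phi m k + 1) / 2))))
    + Real.log (2 * Real.cos (2 / 3 * Real.arcsin (Real.sqrt ((phi m k + 1) / 2))) + 1)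

/-! With y = x³, the roots of y^m = -1 split log(y^m + 1) into a sum of log|1 + y e^{3iφ}|, where φ
runs over the m values `rootAngle m k` in (-π/3, π/3) (`log_pow_add_one`). Everything rests on the
value π²/9 + (π√3/3) log(1 + 2 cos φ) of one such term integrated against x/(1 + x³)
(`integral_mul_log_norm`). That value is the real part of a complex integral. Replace x³ by s³x³
inside the logarithm and differentiate in s; with a = s e^{iφ}, partial fractions reduce the
derivative to the integral of x/(1 + a³x³), which is 2π√3/(9a²). The result is rational in a, so it
integrates explicitly from s = 0 to s = 1. Finally φ ↦ -φ pairs the roots, and the triple-angle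
formula for the sine turns 3 log(1 + 2 cos φ) + log 2 into S_k (`summand_eq`). -/

section

open Complex MeasureTheory Set Filter Topology

/-! ### Unit circle and principal logarithm -/

/-- The point `e^{iψ}` of the unit circle. -/
noncomputable def cis (ψ : ℝ) : ℂ := Complex.exp (ψ * I)

theorem cis_eq (ψ : ℝ) : cis ψ = Real.cos ψ + Real.sin ψ * I := by
  rw [cis, Complex.exp_mul_I, Complex.ofReal_cos, Complex.ofReal_sin]

theorem cis_re (ψ : ℝ) : (cis ψ).re = Real.cos ψ := by
  rw [cis, Complex.exp_ofReal_mul_I_re]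

theorem cis_im (ψ : ℝ) : (cis ψ).im = Real.sin ψ := by
  rw [cis, Complex.exp_ofReal_mul_I_im]

theorem cis_add (ψ χ : ℝ) : cis (ψ + χ) = cis ψ * cis χ := by
  rw [cis, cis, cis, ← Complex.exp_add]
  push_cast
  ring_nf

theorem norm_cis (ψ : ℝ) : ‖cis ψ‖ = 1 := Complex.norm_exp_ofReal_mul_I ψ

theorem cis_ne_zero (ψ : ℝ) : cis ψ ≠ 0 := Complex.exp_ne_zero _

theorem cis_zero : cis 0 = 1 := by simp [cis]

theorem cis_three_mul (ψ : ℝ) : cis (3 * ψ) = cis ψ ^ 3 := by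
  rw [cis, cis, ← Complex.exp_nat_mul]
  push_cast
  ring_nf

theorem log_mul_cis {r ψ : ℝ} (hr : 0 < r) (h₁ : -Real.pi < ψ) (h₂ : ψ < Real.pi) :
    Complex.log (r * cis ψ) = Real.log r + ψ * I := by
  have : (r : ℂ) * cis ψ = Complex.exp (Real.log r + ψ * I) := by
    rw [Complex.exp_add, cis, ← Complex.ofReal_exp, Real.exp_log hr]
  rw [this, Complex.log_exp] <;> simp <;> linarith

theorem mul_cis_mem_slitPlane {r ψ : ℝ} (hr : 0 < r) (h₁ : -Real.pi < ψ) (h₂ : ψ < Real.pi) :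
    (r : ℂ) * cis ψ ∈ slitPlane := by
  rw [Complex.mem_slitPlane_iff]
  by_cases hs : Real.sin ψ = 0
  · have : ψ = 0 := (Real.sin_eq_zero_iff_of_lt_of_lt h₁ h₂).1 hs
    left
    simp [this, cis_zero, hr]
  · right
    simp [cis_im, hs, hr.ne']

theorem one_add_mul_cis_mem_slitPlane {t ψ : ℝ} (ht : 0 ≤ t) (h₁ : -Real.pi < ψ)
    (h₂ : ψ < Real.pi) : 1 + (t : ℂ) * cis ψ ∈ slitPlane := by
  rcases ht.eq_or_lt with rfl | ht
  · simp
  rw [Complex.mem_slitPlane_iff]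
  by_cases hs : Real.sin ψ = 0
  · have : ψ = 0 := (Real.sin_eq_zero_iff_of_lt_of_lt h₁ h₂).1 hs
    left
    simp [this, cis_zero]
    linarith
  · right
    simp [cis_im, hs, ht.ne']

/-- The squares of the two sides differ by sin²(ψ/2)(1 - t)². This keeps 1 + t e^{iψ} away from 0
uniformly in t ≥ 0 and drives every domination bound below. -/
theorem cos_half_mul_le_norm (t ψ : ℝ) :
    Real.cos (ψ / 2) * (1 + t) ≤ ‖1 + (t : ℂ) * cis ψ‖ := by
  refine abs_le_of_sq_le_sq' ?_ (norm_nonneg _) |>.2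
  rw [← Complex.normSq_eq_norm_sq, Complex.normSq_apply]
  have h2 : Real.cos ψ = 2 * Real.cos (ψ / 2) ^ 2 - 1 := by
    rw [← Real.cos_two_mul]; ring_nf
  have h3 := Real.sin_sq_add_cos_sq ψ
  have h4 := Real.cos_sq_le_one (ψ / 2)
  have h5 : (1 + t * Real.cos ψ) * (1 + t * Real.cos ψ) + t * Real.sin ψ * (t * Real.sin ψ) =
      (Real.cos (ψ / 2) * (1 + t)) ^ 2 + (1 - Real.cos (ψ / 2) ^ 2) * (1 - t) ^ 2 := by
    linear_combination t ^ 2 * h3 + 2 * t * h2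
  have h6 := mul_nonneg (sub_nonneg.2 h4) (sq_nonneg (1 - t))
  simp only [add_re, one_re, re_ofReal_mul, cis_re, add_im, one_im, im_ofReal_mul, cis_im,
    zero_add]
  linarith

theorem norm_one_add_mul_cis_le {t ψ : ℝ} (ht : 0 ≤ t) : ‖1 + (t : ℂ) * cis ψ‖ ≤ 1 + t := by
  refine (norm_add_le _ _).trans ?_
  simp [norm_cis, abs_of_nonneg ht]

theorem norm_log_one_add_mul_cis_le {t ψ : ℝ} (ht : 0 ≤ t) (h₁ : -Real.pi < ψ)
    (h₂ : ψ < Real.pi) :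
    ‖Complex.log (1 + (t : ℂ) * cis ψ)‖ ≤
      Real.log (1 + t) + (Real.pi - Real.log (Real.cos (ψ / 2))) := by
  have hc : 0 < Real.cos (ψ / 2) :=
    Real.cos_pos_of_mem_Ioo ⟨by linarith, by linarith⟩
  have hl := cos_half_mul_le_norm t ψ
  have hu := norm_one_add_mul_cis_le (ψ := ψ) ht
  have hp : 0 < Real.cos (ψ / 2) * (1 + t) := by positivity
  have h3 : Real.log (Real.cos (ψ / 2)) ≤ 0 :=
    Real.log_nonpos hc.le (Real.cos_le_one _)
  have h4 : Real.log (Real.cos (ψ / 2)) + Real.log (1 + t) ≤ Real.log ‖1 + (t : ℂ) * cis ψ‖ := by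
    rw [← Real.log_mul hc.ne' (by positivity)]
    exact Real.log_le_log hp hl
  have h5 := Real.log_le_log (hp.trans_le hl) hu
  have h6 : 0 ≤ Real.log (1 + t) := Real.log_nonneg (by linarith)
  refine (Complex.norm_le_abs_re_add_abs_im _).trans ?_
  rw [Complex.log_re, Complex.log_im]
  have := Complex.abs_arg_le_pi (1 + (t : ℂ) * cis ψ)
  have : |Real.log ‖1 + (t : ℂ) * cis ψ‖| ≤ Real.log (1 + t) - Real.log (Real.cos (ψ / 2)) := by
    rw [abs_le]; constructor <;> linarith
  linarith

theorem log_one_add_cis {ψ : ℝ} (h₁ : -Real.pi < ψ) (h₂ : ψ < Real.pi) :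
    Complex.log (1 + cis ψ) = Real.log (2 * Real.cos (ψ / 2)) + (ψ / 2 : ℝ) * I := by
  have hc : 0 < Real.cos (ψ / 2) :=
    Real.cos_pos_of_mem_Ioo ⟨by linarith, by linarith⟩
  have : 1 + cis ψ = (2 * Real.cos (ψ / 2) : ℝ) * cis (ψ / 2) := by
    have h : ψ = 2 * (ψ / 2) := by ring
    apply Complex.ext
    · simp only [add_re, one_re, cis_re, re_ofReal_mul]
      nth_rw 1 [h]
      rw [Real.cos_two_mul]; ring
    · simp only [add_im, one_im, cis_im, im_ofReal_mul]
      nth_rw 1 [h]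
      rw [Real.sin_two_mul]; ring
  rw [this, log_mul_cis (by positivity) (by linarith) (by linarith)]

/-! ### Integrable majorants on the half-line -/

theorem integrableOn_one_add_rpow :
    IntegrableOn (fun x : ℝ => (1 + x) ^ (-(3 / 2) : ℝ)) (Ioi 0) := by
  have h : Integrable (fun x : ℝ => (1 + ‖x‖) ^ (-(3 / 2) : ℝ)) :=
    integrable_one_add_norm (by norm_num)
  refine h.integrableOn.congr_fun (fun x hx => ?_) measurableSet_Ioi
  simp [abs_of_pos (mem_Ioi.1 hx)]

theorem div_one_add_cube_le {x : ℝ} (hx : 0 < x) :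
    x / (1 + x ^ 3) ≤ 4 * (1 + x) ^ (-2 : ℝ) := by
  rw [Real.rpow_neg (by positivity), Real.rpow_two, ← div_eq_mul_inv,
    div_le_div_iff₀ (by positivity) (by positivity)]
  nlinarith [mul_nonneg hx.le (sq_nonneg (x - 1)), sq_nonneg (x - 1), pow_pos hx 3]

theorem integrableOn_div_one_add_cube :
    IntegrableOn (fun x : ℝ => x / (1 + x ^ 3)) (Ioi 0) := by
  refine Integrable.mono' (integrableOn_one_add_rpow.const_mul 4)
    (Measurable.aestronglyMeasurable (by fun_prop))
    ((ae_restrict_iff' measurableSet_Ioi).2 (ae_of_all _ fun x hx => ?_))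
  have hx : 0 < x := hx
  rw [Real.norm_of_nonneg (by positivity)]
  refine (div_one_add_cube_le hx).trans ?_
  gcongr
  · linarith
  · norm_num

theorem integrableOn_mul_log_div :
    IntegrableOn (fun x : ℝ => x / (1 + x ^ 3) * Real.log (1 + x ^ 3)) (Ioi 0) := by
  -- 24 = 4 · 6: the rational factor is at most 4(1 + x)^(-2), and log(1 + x³) ≤ 3 log(1 + x) ≤ 6(1
  -- + x)^(1/2).
  refine Integrable.mono' (integrableOn_one_add_rpow.const_mul 24)
    (Measurable.aestronglyMeasurable (by fun_prop))
    ((ae_restrict_iff' measurableSet_Ioi).2 (ae_of_all _ fun x hx => ?_))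
  have hx : 0 < x := hx
  have hl : 0 ≤ Real.log (1 + x ^ 3) := Real.log_nonneg (by linarith [pow_pos hx 3])
  rw [Real.norm_of_nonneg (by positivity)]
  have h1 : Real.log (1 + x ^ 3) ≤ 6 * (1 + x) ^ (1 / 2 : ℝ) := by
    have h2 : Real.log (1 + x ^ 3) ≤ Real.log ((1 + x) ^ 3) :=
      Real.log_le_log (by positivity) (by nlinarith [pow_pos hx 2])
    have h3 := Real.log_le_rpow_div (x := 1 + x) (ε := 1 / 2) (by positivity) (by norm_num)
    rw [Real.log_pow] at h2
    push_cast at h2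
    linarith
  calc x / (1 + x ^ 3) * Real.log (1 + x ^ 3)
      ≤ (4 * (1 + x) ^ (-2 : ℝ)) * (6 * (1 + x) ^ (1 / 2 : ℝ)) :=
        mul_le_mul (div_one_add_cube_le hx) h1 hl (by positivity)
    _ = 24 * ((1 + x) ^ (-2 : ℝ) * (1 + x) ^ (1 / 2 : ℝ)) := by ring
    _ = 24 * (1 + x) ^ (-(3 / 2) : ℝ) := by
        rw [← Real.rpow_add (by positivity)]; norm_num

/-! ### Cube roots of unity and the integral of x/(1 + a³x³) -/

theorem cis_pi_div_three : cis (Real.pi / 3) = 1 / 2 + (Real.sqrt 3 : ℂ) / 2 * I := by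
  rw [cis_eq, Real.cos_pi_div_three, Real.sin_pi_div_three]; push_cast; rfl

theorem cis_neg_pi_div_three : cis (-(Real.pi / 3)) = 1 / 2 - (Real.sqrt 3 : ℂ) / 2 * I := by
  rw [cis_eq, Real.cos_neg, Real.sin_neg, Real.cos_pi_div_three, Real.sin_pi_div_three]
  push_cast; ring

theorem cis_two_pi_div_three :
    cis (2 * Real.pi / 3) = -1 / 2 + (Real.sqrt 3 : ℂ) / 2 * I := by
  have h : 2 * Real.pi / 3 = Real.pi - Real.pi / 3 := by ring
  rw [cis_eq, h, Real.cos_pi_sub, Real.sin_pi_sub, Real.cos_pi_div_three, Real.sin_pi_div_three]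
  push_cast; ring

theorem cis_neg_two_pi_div_three :
    cis (-(2 * Real.pi / 3)) = -1 / 2 - (Real.sqrt 3 : ℂ) / 2 * I := by
  have h : 2 * Real.pi / 3 = Real.pi - Real.pi / 3 := by ring
  rw [cis_eq, Real.cos_neg, Real.sin_neg, h, Real.cos_pi_sub, Real.sin_pi_sub,
    Real.cos_pi_div_three, Real.sin_pi_div_three]
  push_cast; ring

theorem sqrt_three_sq_complex : (Real.sqrt 3 : ℂ) ^ 2 = 3 := by
  rw [← Complex.ofReal_pow, Real.sq_sqrt (by norm_num)]; norm_num

theorem hasDerivAt_log_one_add_mul_cis {x s ψ : ℝ} (hs : 0 ≤ s) (hx : 0 ≤ x)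
    (h₁ : -Real.pi < ψ) (h₂ : ψ < Real.pi) :
    HasDerivAt (fun x : ℝ => Complex.log (1 + ((s * x : ℝ) : ℂ) * cis ψ))
      (s * cis ψ / (1 + ((s * x : ℝ) : ℂ) * cis ψ)) x := by
  have h := one_add_mul_cis_mem_slitPlane (mul_nonneg hs hx) h₁ h₂
  have hd : HasDerivAt (fun x : ℝ => 1 + ((s * x : ℝ) : ℂ) * cis ψ) (s * cis ψ) x := by
    have := (((hasDerivAt_id x).const_mul s).ofReal_comp.mul_const (cis ψ)).const_add 1
    simpa using this
  exact hd.clog_real h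

theorem tendsto_log_one_add_mul_cis {s ψ : ℝ} (hs : 0 < s)
    (h₁ : -Real.pi < ψ) (h₂ : ψ < Real.pi) :
    Tendsto (fun x : ℝ => Complex.log (1 + ((s * x : ℝ) : ℂ) * cis ψ) - Real.log x) atTop
      (𝓝 (Real.log s + ψ * I)) := by
  rw [← log_mul_cis hs h₁ h₂]
  have hlim : Tendsto (fun x : ℝ => ((x⁻¹ : ℝ) : ℂ) + s * cis ψ) atTop (𝓝 (s * cis ψ)) := by
    have := ((Complex.continuous_ofReal.tendsto 0).comp tendsto_inv_atTop_zero).add_const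
      ((s : ℂ) * cis ψ)
    simpa using this
  refine ((continuousAt_clog (mul_cis_mem_slitPlane hs h₁ h₂)).tendsto.comp hlim).congr' ?_
  filter_upwards [eventually_gt_atTop 0] with x hx
  have hx' : (x : ℂ) ≠ 0 := by exact_mod_cast hx.ne'
  have hne : ((x⁻¹ : ℝ) : ℂ) + s * cis ψ ≠ 0 := by
    have := slitPlane_ne_zero (one_add_mul_cis_mem_slitPlane (mul_nonneg hs.le hx.le) h₁ h₂)
    contrapose! this
    have h2 : 1 + ((s * x : ℝ) : ℂ) * cis ψ = x * (((x⁻¹ : ℝ) : ℂ) + s * cis ψ) := by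
      push_cast; field_simp
    rw [h2, this, mul_zero]
  have h2 : 1 + ((s * x : ℝ) : ℂ) * cis ψ = x * (((x⁻¹ : ℝ) : ℂ) + s * cis ψ) := by
    push_cast; field_simp
  rw [h2, Complex.log_ofReal_mul hx hne]
  simp

theorem one_add_cube_eq_prod (u : ℂ) :
    1 + u ^ 3 = (1 + u) * (1 + u * cis (2 * Real.pi / 3)) * (1 + u * cis (-(2 * Real.pi / 3))) := by
  rw [cis_two_pi_div_three, cis_neg_two_pi_div_three]
  ring_nf
  simp only [Complex.I_sq, sqrt_three_sq_complex]
  ring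

theorem div_one_add_cube_eq {u : ℂ} (h₀ : 1 + u ≠ 0) (h₁ : 1 + u * cis (2 * Real.pi / 3) ≠ 0)
    (h₂ : 1 + u * cis (-(2 * Real.pi / 3)) ≠ 0) :
    u / (1 + u ^ 3) = -(1 / 3) * (1 / (1 + u)
      + cis (2 * Real.pi / 3) ^ 2 / (1 + u * cis (2 * Real.pi / 3))
      + cis (-(2 * Real.pi / 3)) ^ 2 / (1 + u * cis (-(2 * Real.pi / 3)))) := by
  rw [one_add_cube_eq_prod]
  field_simp
  rw [cis_two_pi_div_three, cis_neg_two_pi_div_three]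
  ring_nf
  simp only [Complex.I_sq, sqrt_three_sq_complex]
  ring

theorem norm_div_one_add_mul_cube_cis_le {s x θ : ℝ} (hs : 0 < s) (hx : 0 < x)
    (h₁ : -Real.pi < θ) (h₂ : θ < Real.pi) :
    ‖(x : ℂ) / (1 + ((s * x ^ 3 : ℝ) : ℂ) * cis θ)‖ ≤
      (Real.cos (θ / 2) * min 1 s)⁻¹ * (x / (1 + x ^ 3)) := by
  have hc : 0 < Real.cos (θ / 2) :=
    Real.cos_pos_of_mem_Ioo ⟨by linarith, by linarith⟩
  have hm : 0 < min 1 s := lt_min one_pos hs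
  have h := cos_half_mul_le_norm (s * x ^ 3) θ
  have h3 : min 1 s * (1 + x ^ 3) ≤ 1 + s * x ^ 3 := by
    have h4 := min_le_left 1 s
    have h5 := mul_le_mul_of_nonneg_right (min_le_right 1 s) (pow_pos hx 3).le
    linarith
  have h6 : Real.cos (θ / 2) * min 1 s * (1 + x ^ 3) ≤
      ‖1 + ((s * x ^ 3 : ℝ) : ℂ) * cis θ‖ := by
    rw [mul_assoc]
    exact (mul_le_mul_of_nonneg_left h3 hc.le).trans h
  rw [norm_div, Complex.norm_real, Real.norm_of_nonneg hx.le, inv_mul_eq_div, div_div]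
  gcongr x / ?_
  linarith

theorem integrableOn_div_one_add_mul_cube_cis {s θ : ℝ} (hs : 0 < s)
    (h₁ : -Real.pi < θ) (h₂ : θ < Real.pi) :
    IntegrableOn (fun x : ℝ => (x : ℂ) / (1 + ((s * x ^ 3 : ℝ) : ℂ) * cis θ)) (Ioi 0) := by
  refine Integrable.mono' (integrableOn_div_one_add_cube.const_mul
    (Real.cos (θ / 2) * min 1 s)⁻¹) (Measurable.aestronglyMeasurable (by fun_prop))
    ((ae_restrict_iff' measurableSet_Ioi).2 (ae_of_all _ fun x hx => ?_))
  exact norm_div_one_add_mul_cube_cis_le hs hx h₁ h₂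

/-- Partial fractions over the cube roots of unity give a primitive made of three logarithms. The
range of φ keeps φ and φ ± 2π/3 inside (-π, π), so principal branches suffice. -/
theorem integral_div_one_add_mul_cube_cis {s φ : ℝ} (hs : 0 < s)
    (h₁ : -(Real.pi / 3) < φ) (h₂ : φ < Real.pi / 3) :
    ∫ x in Ioi (0 : ℝ), (x : ℂ) / (1 + ((s ^ 3 * x ^ 3 : ℝ) : ℂ) * cis (3 * φ)) =
      2 * Real.pi * Real.sqrt 3 / 9 / (s * cis φ) ^ 2 := by
  have hπ := Real.pi_pos
  set ω := cis (2 * Real.pi / 3) with hω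
  set ω' := cis (-(2 * Real.pi / 3)) with hω'
  have ha : (s : ℂ) * cis φ ≠ 0 := mul_ne_zero (by exact_mod_cast hs.ne') (cis_ne_zero _)
  have hsum : 1 + ω + ω' = 0 := by
    rw [hω, hω', cis_two_pi_div_three, cis_neg_two_pi_div_three]; ring
  let ℓ : ℝ → ℝ → ℂ := fun ψ x => Complex.log (1 + ((s * x : ℝ) : ℂ) * cis ψ)
  let P : ℝ → ℂ := fun x => -(1 / 3) / (s * cis φ) ^ 2 *
    (ℓ φ x + ω * ℓ (φ + 2 * Real.pi / 3) x + ω' * ℓ (φ + -(2 * Real.pi / 3)) x)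
  have hder : ∀ x : ℝ, 0 ≤ x →
      HasDerivAt P ((x : ℂ) / (1 + ((s ^ 3 * x ^ 3 : ℝ) : ℂ) * cis (3 * φ))) x := by
    intro x hx
    have d0 := hasDerivAt_log_one_add_mul_cis hs.le hx (ψ := φ) (by linarith) (by linarith)
    have d1 := hasDerivAt_log_one_add_mul_cis hs.le hx (ψ := φ + 2 * Real.pi / 3)
      (by linarith) (by linarith)
    have d2 := hasDerivAt_log_one_add_mul_cis hs.le hx (ψ := φ + -(2 * Real.pi / 3))
      (by linarith) (by linarith)
    have n0 := slitPlane_ne_zero (one_add_mul_cis_mem_slitPlane (mul_nonneg hs.le hx) (ψ := φ)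
      (by linarith) (by linarith))
    have n1 := slitPlane_ne_zero (one_add_mul_cis_mem_slitPlane (mul_nonneg hs.le hx)
      (ψ := φ + 2 * Real.pi / 3) (by linarith) (by linarith))
    have n2 := slitPlane_ne_zero (one_add_mul_cis_mem_slitPlane (mul_nonneg hs.le hx)
      (ψ := φ + -(2 * Real.pi / 3)) (by linarith) (by linarith))
    refine (((d0.add (d1.const_mul ω)).add (d2.const_mul ω')).const_mul
      (-(1 / 3) / (s * cis φ) ^ 2)).congr_deriv ?_
    rw [cis_add, ← hω, ← mul_assoc] at n1 ⊢
    rw [cis_add, ← hω', ← mul_assoc] at n2 ⊢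
    have key := div_one_add_cube_eq n0 n1 n2
    have e1 : (x : ℂ) / (1 + ((s ^ 3 * x ^ 3 : ℝ) : ℂ) * cis (3 * φ)) =
        (((s * x : ℝ) : ℂ) * cis φ) / (1 + (((s * x : ℝ) : ℂ) * cis φ) ^ 3) / (s * cis φ) := by
      rw [cis_three_mul]
      push_cast
      rw [div_right_comm]
      congr 1
      · rw [eq_div_iff ha]
        ring
      · ring
    rw [e1, key, ← hω, ← hω']
    field_simp
  have hlim : Tendsto P atTop (𝓝 (2 * Real.pi * Real.sqrt 3 / 9 / (s * cis φ) ^ 2)) := by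
    have t0 := tendsto_log_one_add_mul_cis hs (ψ := φ) (by linarith) (by linarith)
    have t1 := tendsto_log_one_add_mul_cis hs (ψ := φ + 2 * Real.pi / 3)
      (by linarith) (by linarith)
    have t2 := tendsto_log_one_add_mul_cis hs (ψ := φ + -(2 * Real.pi / 3))
      (by linarith) (by linarith)
    have t := ((t0.add (t1.const_mul ω)).add (t2.const_mul ω')).const_mul
      (-(1 / 3) / (s * cis φ) ^ 2)
    convert t using 1
    · ext x
      simp only [P, ℓ]
      -- The divergent log x cancels because the weights 1, ω, ω' sum to 0.
      linear_combination (-(1 / 3) / (s * cis φ) ^ 2) * Real.log x * hsum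
    · congr 1
      have hd : ω - ω' = Real.sqrt 3 * I := by
        rw [hω, hω', cis_two_pi_div_three, cis_neg_two_pi_div_three]; ring
      push_cast
      linear_combination (1 / 3 / (s * cis φ) ^ 2) * ((Real.log s + φ * I) * hsum
        + 2 * Real.pi / 3 * I * hd + 2 * Real.pi / 3 * Real.sqrt 3 * Complex.I_sq)
  have h0 : P 0 = 0 := by simp [P, ℓ]
  rw [integral_Ioi_of_hasDerivAt_of_tendsto (hder 0 le_rfl).continuousAt.continuousWithinAt
    (fun x hx => hder x (le_of_lt hx))
    (integrableOn_div_one_add_mul_cube_cis (pow_pos hs 3) (by linarith) (by linarith)) hlim,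
    h0, sub_zero]

/-! ### Differentiation under the integral sign -/

/-- The logarithmic integrand with the scaling parameter `s`. -/
noncomputable def logIntegrand (θ s x : ℝ) : ℂ :=
  ((x / (1 + x ^ 3) : ℝ) : ℂ) * Complex.log (1 + ((s ^ 3 * x ^ 3 : ℝ) : ℂ) * cis θ)

/-- The derivative of `logIntegrand` in the scaling parameter. -/
noncomputable def logIntegrandDeriv (θ s x : ℝ) : ℂ :=
  ((3 * s ^ 2 * (x ^ 3 / (1 + x ^ 3)) : ℝ) : ℂ) * cis θ *
    (x / (1 + ((s ^ 3 * x ^ 3 : ℝ) : ℂ) * cis θ))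

theorem measurable_logIntegrand (θ s : ℝ) : Measurable (logIntegrand θ s) := by
  unfold logIntegrand
  fun_prop

theorem measurable_logIntegrandDeriv (θ s : ℝ) : Measurable (logIntegrandDeriv θ s) := by
  unfold logIntegrandDeriv
  fun_prop

theorem norm_logIntegrand_le {θ s x : ℝ} (hs : s ∈ Icc (0 : ℝ) 1) (hx : 0 < x)
    (h₁ : -Real.pi < θ) (h₂ : θ < Real.pi) :
    ‖logIntegrand θ s x‖ ≤ x / (1 + x ^ 3) * Real.log (1 + x ^ 3) +
      (Real.pi - Real.log (Real.cos (θ / 2))) * (x / (1 + x ^ 3)) := by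
  have ht : 0 ≤ s ^ 3 * x ^ 3 := mul_nonneg (pow_nonneg hs.1 3) (pow_pos hx 3).le
  have h := norm_log_one_add_mul_cis_le ht h₁ h₂
  have h3 : Real.log (1 + s ^ 3 * x ^ 3) ≤ Real.log (1 + x ^ 3) := by
    apply Real.log_le_log (by positivity)
    have := mul_le_mul_of_nonneg_right (pow_le_one₀ hs.1 hs.2 (n := 3)) (pow_pos hx 3).le
    linarith
  rw [logIntegrand, norm_mul, Complex.norm_real, Real.norm_of_nonneg (by positivity)]
  calc _ ≤ x / (1 + x ^ 3) *
        (Real.log (1 + x ^ 3) + (Real.pi - Real.log (Real.cos (θ / 2)))) := by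
        gcongr; linarith
    _ = _ := by ring

theorem integrableOn_logIntegrand_bound (D : ℝ) :
    IntegrableOn (fun x : ℝ => x / (1 + x ^ 3) * Real.log (1 + x ^ 3) +
      D * (x / (1 + x ^ 3))) (Ioi 0) :=
  integrableOn_mul_log_div.add (integrableOn_div_one_add_cube.const_mul D)

theorem integrableOn_logIntegrand {θ s : ℝ} (hs : s ∈ Icc (0 : ℝ) 1)
    (h₁ : -Real.pi < θ) (h₂ : θ < Real.pi) : IntegrableOn (logIntegrand θ s) (Ioi 0) :=
  Integrable.mono' (integrableOn_logIntegrand_bound _)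
    (measurable_logIntegrand θ s).aestronglyMeasurable
    ((ae_restrict_iff' measurableSet_Ioi).2
      (ae_of_all _ fun _ hx => norm_logIntegrand_le hs hx h₁ h₂))

theorem hasDerivAt_logIntegrand {θ s x : ℝ} (hs : 0 ≤ s) (hx : 0 < x)
    (h₁ : -Real.pi < θ) (h₂ : θ < Real.pi) :
    HasDerivAt (fun s => logIntegrand θ s x) (logIntegrandDeriv θ s x) s := by
  have hm := one_add_mul_cis_mem_slitPlane (mul_nonneg (pow_nonneg hs 3) (pow_pos hx 3).le) h₁ h₂
  have hd : HasDerivAt (fun s : ℝ => 1 + ((s ^ 3 * x ^ 3 : ℝ) : ℂ) * cis θ)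
      (((3 * s ^ 2 * x ^ 3 : ℝ) : ℂ) * cis θ) s := by
    have := (((hasDerivAt_pow 3 s).mul_const (x ^ 3)).ofReal_comp.mul_const (cis θ)).const_add 1
    simpa using this
  refine ((hd.clog_real hm).const_mul ((x / (1 + x ^ 3) : ℝ) : ℂ)).congr_deriv ?_
  rw [logIntegrandDeriv]
  push_cast
  ring

/-- Staying above δ makes the majorant independent of s, as dominated differentiation requires. -/
theorem norm_logIntegrandDeriv_le {θ δ s x : ℝ} (hδ : 0 < δ) (hs : s ∈ Ioo δ 1) (hx : 0 < x)
    (h₁ : -Real.pi < θ) (h₂ : θ < Real.pi) :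
    ‖logIntegrandDeriv θ s x‖ ≤ 3 * (Real.cos (θ / 2) * δ ^ 3)⁻¹ * (x / (1 + x ^ 3)) := by
  have hc : 0 < Real.cos (θ / 2) :=
    Real.cos_pos_of_mem_Ioo ⟨by linarith, by linarith⟩
  have hs0 : 0 < s := hδ.trans hs.1
  have hδs : δ ^ 3 ≤ min 1 (s ^ 3) :=
    le_min (pow_le_one₀ hδ.le (hs.1.trans hs.2).le) (pow_le_pow_left₀ hδ.le hs.1.le 3)
  have h := norm_div_one_add_mul_cube_cis_le (pow_pos hs0 3) hx h₁ h₂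
  have h3 : (3 * s ^ 2 * (x ^ 3 / (1 + x ^ 3)) : ℝ) ≤ 3 := by
    have h4 : s ^ 2 ≤ 1 := pow_le_one₀ hs0.le hs.2.le
    have h5 : x ^ 3 / (1 + x ^ 3) ≤ 1 := by
      rw [div_le_one (by positivity)]; linarith
    have h6 : s ^ 2 * (x ^ 3 / (1 + x ^ 3)) ≤ 1 := mul_le_one₀ h4 (by positivity) h5
    linarith
  rw [logIntegrandDeriv, norm_mul, norm_mul, norm_cis, mul_one, Complex.norm_real,
    Real.norm_of_nonneg (by positivity),
    mul_assoc 3 (Real.cos (θ / 2) * δ ^ 3)⁻¹]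
  refine mul_le_mul h3 (h.trans ?_) (norm_nonneg _) (by norm_num)
  gcongr

/-- With b = a³, x³/((1 + x³)(1 + bx³)) = (1/(1 + bx³) - 1/(1 + x³))/(1 - b), where s < 1 ensures b
≠ 1. Both pieces are known integrals, and (1 - a²)/(1 - a³) simplifies by 1 - a. -/
theorem integral_logIntegrandDeriv {φ s : ℝ} (hs : s ∈ Ioo (0 : ℝ) 1)
    (h₁ : -(Real.pi / 3) < φ) (h₂ : φ < Real.pi / 3) :
    ∫ x in Ioi (0 : ℝ), logIntegrandDeriv (3 * φ) s x =
      2 * Real.pi * Real.sqrt 3 / 3 * (cis φ * (1 + s * cis φ) /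
        (1 + s * cis φ + (s * cis φ) ^ 2)) := by
  have hπ := Real.pi_pos
  set a : ℂ := s * cis φ with ha
  have ha0 : a ≠ 0 := mul_ne_zero (by exact_mod_cast hs.1.ne') (cis_ne_zero _)
  have hna : ‖a‖ < 1 := by
    rw [ha, norm_mul, norm_cis, mul_one, Complex.norm_real, Real.norm_of_nonneg hs.1.le]
    exact hs.2
  have h3 : 1 - a ^ 3 ≠ 0 := by
    intro h
    have h4 : ‖a‖ ^ 3 = 1 := by rw [← norm_pow, ← sub_eq_zero.1 h, norm_one]
    have := pow_lt_one₀ (norm_nonneg a) hna (n := 3) (by norm_num)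
    linarith
  have hfac : 1 - a ^ 3 = (1 - a) * (1 + a + a ^ 2) := by ring
  have h5 : 1 - a ≠ 0 := fun h => h3 (by rw [hfac, h, zero_mul])
  have h6 : 1 + a + a ^ 2 ≠ 0 := fun h => h3 (by rw [hfac, h, mul_zero])
  have hb : ((s ^ 3 : ℝ) : ℂ) * cis (3 * φ) = a ^ 3 := by
    rw [cis_three_mul, ha]; push_cast; ring
  have i1 := integral_div_one_add_mul_cube_cis hs.1 h₁ h₂
  have i2 := integral_div_one_add_mul_cube_cis one_pos (φ := 0) (by linarith) (by linarith)
  have j1 := integrableOn_div_one_add_mul_cube_cis (θ := 3 * φ) (pow_pos hs.1 3)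
    (by linarith) (by linarith)
  have j2 := integrableOn_div_one_add_mul_cube_cis (s := 1 ^ 3) (θ := 3 * 0) (by norm_num)
    (by linarith) (by linarith)
  have hpt : ∀ x ∈ Ioi (0 : ℝ), logIntegrandDeriv (3 * φ) s x =
      (3 * s ^ 2 * cis (3 * φ) / (1 - a ^ 3)) *
        ((x : ℂ) / (1 + ((s ^ 3 * x ^ 3 : ℝ) : ℂ) * cis (3 * φ)) -
          (x : ℂ) / (1 + ((1 ^ 3 * x ^ 3 : ℝ) : ℂ) * cis (3 * 0))) := by
    intro x hx
    have hx : 0 < x := hx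
    have n1 := slitPlane_ne_zero (one_add_mul_cis_mem_slitPlane (ψ := 3 * φ)
      (mul_nonneg (pow_pos hs.1 3).le (pow_pos hx 3).le) (by linarith) (by linarith))
    have n2 : (1 + (x : ℂ) ^ 3) ≠ 0 := by
      have : (1 + x ^ 3) ≠ 0 := by positivity
      exact_mod_cast this
    have hb' : ((s ^ 3 * x ^ 3 : ℝ) : ℂ) * cis (3 * φ) = a ^ 3 * x ^ 3 := by
      rw [← hb]; push_cast; ring
    rw [logIntegrandDeriv, hb', mul_zero, cis_zero]
    rw [hb'] at n1
    push_cast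
    rw [one_pow, one_mul, mul_one]
    obtain ⟨N, hN⟩ : ∃ N, N = 1 + a ^ 3 * (x : ℂ) ^ 3 := ⟨_, rfl⟩
    rw [← hN] at n1 ⊢
    field_simp
    rw [hN]
    ring
  rw [setIntegral_congr_fun measurableSet_Ioi hpt, integral_const_mul, integral_sub j1 j2, i1, i2,
    cis_zero, ← ha]
  have hb2 : (s : ℂ) ^ 2 * cis (3 * φ) = a ^ 2 * cis φ := by
    rw [cis_three_mul, ha]; ring
  rw [mul_assoc 3, hb2, hfac]
  push_cast
  field_simp
  ring

theorem hasDerivAt_integral_logIntegrand {φ s : ℝ} (hs : s ∈ Ioo (0 : ℝ) 1)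
    (h₁ : -(Real.pi / 3) < φ) (h₂ : φ < Real.pi / 3) :
    HasDerivAt (fun s => ∫ x in Ioi (0 : ℝ), logIntegrand (3 * φ) s x)
      (2 * Real.pi * Real.sqrt 3 / 3 * (cis φ * (1 + s * cis φ) /
        (1 + s * cis φ + (s * cis φ) ^ 2))) s := by
  rw [← integral_logIntegrandDeriv hs h₁ h₂]
  have hs2 : 0 < s / 2 := half_pos hs.1
  have h3 : -Real.pi < 3 * φ := by linarith
  have h4 : 3 * φ < Real.pi := by linarith
  refine (hasDerivAt_integral_of_dominated_loc_of_deriv_le (s := Ioo (s / 2) 1)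
    (bound := fun x => 3 * (Real.cos (3 * φ / 2) * (s / 2) ^ 3)⁻¹ * (x / (1 + x ^ 3)))
    (Ioo_mem_nhds (half_lt_self hs.1) hs.2)
    (Eventually.of_forall fun t => (measurable_logIntegrand _ t).aestronglyMeasurable)
    (integrableOn_logIntegrand ⟨hs.1.le, hs.2.le⟩ h3 h4)
    (measurable_logIntegrandDeriv _ s).aestronglyMeasurable
    ((ae_restrict_iff' measurableSet_Ioi).2 (ae_of_all _ fun _ hx _ ht =>
      norm_logIntegrandDeriv_le hs2 ht hx h3 h4))
    (integrableOn_div_one_add_cube.const_mul _)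
    ((ae_restrict_iff' measurableSet_Ioi).2 (ae_of_all _ fun _ hx _ ht =>
      hasDerivAt_logIntegrand (hs2.trans ht.1).le hx h3 h4))).2

theorem continuousOn_integral_logIntegrand {θ : ℝ} (h₁ : -Real.pi < θ) (h₂ : θ < Real.pi) :
    ContinuousOn (fun s => ∫ x in Ioi (0 : ℝ), logIntegrand θ s x) (Icc 0 1) :=
  continuousOn_of_dominated
    (fun _ _ => (measurable_logIntegrand θ _).aestronglyMeasurable)
    (fun _ hs => (ae_restrict_iff' measurableSet_Ioi).2
      (ae_of_all _ fun _ hx => norm_logIntegrand_le hs hx h₁ h₂))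
    (integrableOn_logIntegrand_bound _)
    ((ae_restrict_iff' measurableSet_Ioi).2 (ae_of_all _ fun _ hx _ hs =>
      (hasDerivAt_logIntegrand hs.1 hx h₁ h₂).continuousAt.continuousWithinAt))

/-! ### Integration in s and the value at s = 1 -/

/-- An antiderivative of `s ↦ cis φ * (1 + a) / (1 + a + a ^ 2)`, where `a = s * cis φ`. -/
noncomputable def logPrimitive (φ s : ℝ) : ℂ :=
  (1 / 2 - (Real.sqrt 3 : ℂ) / 6 * I) *
      Complex.log (1 + ((1 * s : ℝ) : ℂ) * cis (φ + Real.pi / 3)) +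
    (1 / 2 + (Real.sqrt 3 : ℂ) / 6 * I) *
      Complex.log (1 + ((1 * s : ℝ) : ℂ) * cis (φ + -(Real.pi / 3)))

/-- This is the partial fraction decomposition over 1 + a + a² = (1 + a e^{iπ/3})(1 + a e^{-iπ/3}).
-/
theorem hasDerivAt_logPrimitive {φ s : ℝ} (hs : 0 ≤ s)
    (h₁ : -(Real.pi / 3) < φ) (h₂ : φ < Real.pi / 3) :
    HasDerivAt (logPrimitive φ) (cis φ * (1 + s * cis φ) /
        (1 + s * cis φ + (s * cis φ) ^ 2)) s := by
  have d1 := hasDerivAt_log_one_add_mul_cis zero_le_one hs (ψ := φ + Real.pi / 3)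
    (by linarith) (by linarith)
  have d2 := hasDerivAt_log_one_add_mul_cis zero_le_one hs (ψ := φ + -(Real.pi / 3))
    (by linarith) (by linarith)
  have n1 := slitPlane_ne_zero (one_add_mul_cis_mem_slitPlane hs (ψ := φ + Real.pi / 3)
    (by linarith) (by linarith))
  have n2 := slitPlane_ne_zero (one_add_mul_cis_mem_slitPlane hs (ψ := φ + -(Real.pi / 3))
    (by linarith) (by linarith))
  refine ((d1.const_mul (1 / 2 - (Real.sqrt 3 : ℂ) / 6 * I)).add
    (d2.const_mul (1 / 2 + (Real.sqrt 3 : ℂ) / 6 * I))).congr_deriv ?_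
  rw [one_mul, cis_add, cis_add, cis_pi_div_three, cis_neg_pi_div_three]
  rw [cis_add, cis_pi_div_three] at n1
  rw [cis_add, cis_neg_pi_div_three] at n2
  set p : ℂ := 1 / 2 + (Real.sqrt 3 : ℂ) / 2 * I with hp
  set q : ℂ := 1 / 2 - (Real.sqrt 3 : ℂ) / 2 * I with hq
  have hsum : p + q = 1 := by rw [hp, hq]; ring
  have hmul : p * q = 1 := by
    rw [hp, hq]
    linear_combination (1 / 4 : ℂ) * sqrt_three_sq_complex - Real.sqrt 3 ^ 2 / 4 * Complex.I_sq
  have hAB : (1 / 2 - (Real.sqrt 3 : ℂ) / 6 * I) * p + (1 / 2 + (Real.sqrt 3 : ℂ) / 6 * I) * q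
      = 1 := by
    rw [hp, hq]
    linear_combination (1 / 6 : ℂ) * sqrt_three_sq_complex - Real.sqrt 3 ^ 2 / 6 * Complex.I_sq
  have hden : 1 + s * cis φ + (s * cis φ) ^ 2 =
      (1 + s * (cis φ * p)) * (1 + s * (cis φ * q)) := by
    linear_combination -(s * cis φ) * hsum - (s * cis φ) ^ 2 * hmul
  rw [hden]
  clear_value p q
  push_cast
  rw [one_mul, mul_div_assoc', mul_div_assoc', div_add_div _ _ n1 n2]
  congr 1
  linear_combination cis φ * hAB + cis φ ^ 2 * s * hmul

/-- The difference of the two sides, as a function of s, vanishes at 0 and has zero derivative on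
(0, 1); continuity on [0, 1] carries this to s = 1. -/
theorem integral_logIntegrand_one {φ : ℝ}
    (h₁ : -(Real.pi / 3) < φ) (h₂ : φ < Real.pi / 3) :
    ∫ x in Ioi (0 : ℝ), logIntegrand (3 * φ) 1 x =
      2 * Real.pi * Real.sqrt 3 / 3 * logPrimitive φ 1 := by
  have hc := continuousOn_integral_logIntegrand (θ := 3 * φ) (by linarith) (by linarith)
  have hF : ContinuousOn (logPrimitive φ) (Icc 0 1) := fun s hs =>
    (hasDerivAt_logPrimitive hs.1 h₁ h₂).continuousAt.continuousWithinAt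
  have hd : ∀ s ∈ Ioo (0 : ℝ) 1, HasDerivAt
      (fun s => (∫ x in Ioi (0 : ℝ), logIntegrand (3 * φ) s x) -
        2 * Real.pi * Real.sqrt 3 / 3 * logPrimitive φ s) 0 s := by
    intro s hs
    have := (hasDerivAt_integral_logIntegrand hs h₁ h₂).sub
      ((hasDerivAt_logPrimitive hs.1.le h₁ h₂).const_mul (2 * Real.pi * Real.sqrt 3 / 3 : ℂ))
    rwa [sub_self] at this
  have h := intervalIntegral.integral_eq_sub_of_hasDerivAt_of_le zero_le_one
    (hc.sub (hF.const_mul (2 * Real.pi * Real.sqrt 3 / 3 : ℂ))) hd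
    (by simp)
  have z1 : ∫ x in Ioi (0 : ℝ), logIntegrand (3 * φ) 0 x = 0 := by simp [logIntegrand]
  have z2 : logPrimitive φ 0 = 0 := by simp [logPrimitive]
  rw [intervalIntegral.integral_zero] at h
  simp only [Pi.sub_apply] at h
  rw [z1, z2] at h
  linear_combination -h

/-- The moduli of the two factors multiply to 1 + 2 cos φ. Their arguments (φ ± π/3)/2 enter with
opposite weights ±√3/6, so φ drops out. -/
theorem logPrimitive_one_re {φ : ℝ} (h₁ : -(Real.pi / 3) < φ) (h₂ : φ < Real.pi / 3) :
    (logPrimitive φ 1).re =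
      Real.log (1 + 2 * Real.cos φ) / 2 + Real.sqrt 3 * Real.pi / 18 := by
  have c1 : 0 < Real.cos ((φ + Real.pi / 3) / 2) :=
    Real.cos_pos_of_mem_Ioo ⟨by linarith, by linarith⟩
  have c2 : 0 < Real.cos ((φ + -(Real.pi / 3)) / 2) :=
    Real.cos_pos_of_mem_Ioo ⟨by linarith, by linarith⟩
  have hprod : 1 + 2 * Real.cos φ = 2 * Real.cos ((φ + Real.pi / 3) / 2) *
      (2 * Real.cos ((φ + -(Real.pi / 3)) / 2)) := by
    have h := Real.cos_add_cos φ (Real.pi / 3)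
    rw [Real.cos_pi_div_three] at h
    rw [← sub_eq_add_neg]
    linarith
  rw [hprod, Real.log_mul (by positivity) (by positivity), logPrimitive]
  rw [one_mul, Complex.ofReal_one, one_mul, one_mul, log_one_add_cis (by linarith) (by linarith),
    log_one_add_cis (by linarith) (by linarith)]
  have e1 : (1 / 2 - (Real.sqrt 3 : ℂ) / 6 * I) =
      ((1 / 2 : ℝ) : ℂ) - ((Real.sqrt 3 / 6 : ℝ) : ℂ) * I := by
    push_cast; rfl
  have e2 : (1 / 2 + (Real.sqrt 3 : ℂ) / 6 * I) =
      ((1 / 2 : ℝ) : ℂ) + ((Real.sqrt 3 / 6 : ℝ) : ℂ) * I := by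
    push_cast; rfl
  rw [e1, e2]
  simp only [add_re, sub_re, mul_re, ofReal_re, ofReal_im, I_re, I_im, add_im, sub_im, mul_im]
  ring

theorem re_logIntegrand_one (θ x : ℝ) :
    (logIntegrand θ 1 x).re =
      x / (1 + x ^ 3) * Real.log ‖1 + ((x ^ 3 : ℝ) : ℂ) * cis θ‖ := by
  rw [logIntegrand, re_ofReal_mul, Complex.log_re, one_pow, one_mul]

theorem integrableOn_mul_log_norm {θ : ℝ} (h₁ : -Real.pi < θ) (h₂ : θ < Real.pi) :
    IntegrableOn (fun x : ℝ => x / (1 + x ^ 3) *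
      Real.log ‖1 + ((x ^ 3 : ℝ) : ℂ) * cis θ‖) (Ioi 0) := by
  have h := (integrableOn_logIntegrand (s := 1) ⟨zero_le_one, le_rfl⟩ h₁ h₂).re
  exact h.congr (ae_of_all _ fun x => re_logIntegrand_one θ x)

theorem integral_mul_log_norm {φ : ℝ} (h₁ : -(Real.pi / 3) < φ) (h₂ : φ < Real.pi / 3) :
    ∫ x in Ioi (0 : ℝ), x / (1 + x ^ 3) *
        Real.log ‖1 + ((x ^ 3 : ℝ) : ℂ) * cis (3 * φ)‖ =
      Real.pi ^ 2 / 9 + Real.pi * Real.sqrt 3 / 3 * Real.log (1 + 2 * Real.cos φ) := by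
  have hi := integrableOn_logIntegrand (θ := 3 * φ) (s := 1) ⟨zero_le_one, le_rfl⟩
    (by linarith) (by linarith)
  have h := reCLM.integral_comp_comm hi
  simp only [reCLM_apply, re_logIntegrand_one] at h
  rw [h, integral_logIntegrand_one h₁ h₂]
  have e : (2 * Real.pi * Real.sqrt 3 / 3 : ℂ) = ((2 * Real.pi * Real.sqrt 3 / 3 : ℝ) : ℂ) := by
    push_cast; rfl
  rw [e, re_ofReal_mul, logPrimitive_one_re h₁ h₂]
  have h3 := Real.mul_self_sqrt (show (0 : ℝ) ≤ 3 by norm_num)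
  linear_combination Real.pi ^ 2 / 27 * h3

/-! ### Factorisation of y^m + 1 -/

/-- One third of the argument of `-e^{-i (2 k + 1) π / m}`. -/
noncomputable def rootAngle (m k : ℕ) : ℝ := (Real.pi - (2 * (k : ℝ) + 1) * Real.pi / m) / 3

theorem rootAngle_mem {m k : ℕ} (hk : k < m) :
    -(Real.pi / 3) < rootAngle m k ∧ rootAngle m k < Real.pi / 3 := by
  have hπ := Real.pi_pos
  have hm : (0 : ℝ) < m := by exact_mod_cast (Nat.zero_le k).trans_lt hk
  have hk' : (k : ℝ) + 1 ≤ m := by exact_mod_cast hk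
  have h1 : 0 < (2 * (k : ℝ) + 1) * Real.pi / m := by positivity
  have h2 : (2 * (k : ℝ) + 1) * Real.pi / m < 2 * Real.pi := by
    rw [div_lt_iff₀ hm]
    nlinarith
  constructor <;> rw [rootAngle] <;> linarith

theorem rootAngle_reflect {m j k : ℕ} (h : j + k + 1 = m) :
    rootAngle m j = -rootAngle m k := by
  have hm : (m : ℝ) = j + k + 1 := by exact_mod_cast h.symm
  have hm0 : (j : ℝ) + k + 1 ≠ 0 := by positivity
  rw [rootAngle, rootAngle, hm]
  field_simp
  ring

theorem pow_add_one_eq_prod {m : ℕ} (hm : 0 < m) (y : ℂ) :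
    y ^ m + 1 = ∏ k ∈ Finset.range m, (y + cis (-(3 * rootAngle m k))) := by
  have hm' : (m : ℂ) ≠ 0 := by exact_mod_cast hm.ne'
  have hα : cis (Real.pi / m) ^ m = -1 := by
    rw [cis, ← Complex.exp_nat_mul, ← Complex.exp_pi_mul_I]
    congr 1
    push_cast
    field_simp
  have h := congrArg (Polynomial.eval y)
    (X_pow_sub_C_eq_prod (Complex.isPrimitiveRoot_exp m hm.ne') hm hα)
  rw [Polynomial.eval_prod] at h
  simp only [Polynomial.eval_sub, Polynomial.eval_pow, Polynomial.eval_X, Polynomial.eval_C,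
    sub_neg_eq_add] at h
  rw [h]
  refine Finset.prod_congr rfl fun k _ => ?_
  rw [sub_eq_add_neg]
  congr 1
  rw [cis, cis, ← Complex.exp_nat_mul, ← Complex.exp_add, ← neg_one_mul, ← Complex.exp_pi_mul_I,
    ← Complex.exp_add, Complex.exp_eq_exp_iff_exists_int]
  -- Writing -1 as e^{iπ} rather than e^{-iπ} shifts the exponent by one period 2πi.
  refine ⟨1, ?_⟩
  rw [rootAngle]
  push_cast
  field_simp
  ring

theorem norm_add_cis_neg (y ψ : ℝ) : ‖(y : ℂ) + cis (-ψ)‖ = ‖1 + (y : ℂ) * cis ψ‖ := by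
  have h : 1 + (y : ℂ) * cis ψ = cis ψ * (y + cis (-ψ)) := by
    rw [mul_add, ← cis_add, add_neg_cancel, cis_zero]; ring
  rw [h, norm_mul, norm_cis, one_mul]

theorem log_pow_add_one {m : ℕ} (hm : 0 < m) {y : ℝ} (hy : 0 ≤ y) :
    Real.log (y ^ m + 1) =
      ∑ k ∈ Finset.range m, Real.log ‖1 + (y : ℂ) * cis (3 * rootAngle m k)‖ := by
  rw [← Real.log_prod]
  · congr 1
    have h := congrArg norm (pow_add_one_eq_prod hm (y : ℂ))
    rw [norm_prod] at h
    simp only [norm_add_cis_neg] at h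
    rw [← h, ← Complex.ofReal_pow, ← Complex.ofReal_one, ← Complex.ofReal_add, Complex.norm_real,
      Real.norm_of_nonneg (by positivity)]
  · intro k hk
    obtain ⟨h1, h2⟩ := rootAngle_mem (Finset.mem_range.1 hk)
    exact norm_ne_zero_iff.2 (slitPlane_ne_zero
      (one_add_mul_cis_mem_slitPlane hy (by linarith) (by linarith)))

theorem integrand_eq_sum {m : ℕ} (hm : 0 < m) {x : ℝ} (hx : x ∈ Ioi (0 : ℝ)) :
    x * Real.log (x ^ (3 * m) + 1) / (x ^ 3 + 1) =
      ∑ k ∈ Finset.range m, x / (1 + x ^ 3) *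
        Real.log ‖1 + ((x ^ 3 : ℝ) : ℂ) * cis (3 * rootAngle m k)‖ := by
  rw [← Finset.mul_sum, ← log_pow_add_one hm (pow_pos hx 3).le, pow_mul, add_comm (x ^ 3) 1]
  ring

theorem integrableOn_mul_log_pow {m : ℕ} (hm : 0 < m) :
    IntegrableOn (fun x : ℝ => x * Real.log (x ^ (3 * m) + 1) / (x ^ 3 + 1)) (Ioi 0) := by
  refine IntegrableOn.congr_fun ?_ (fun x hx => (integrand_eq_sum hm hx).symm) measurableSet_Ioi
  refine integrable_finsetSum _ fun k hk => ?_
  obtain ⟨h1, h2⟩ := rootAngle_mem (Finset.mem_range.1 hk)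
  exact integrableOn_mul_log_norm (by linarith) (by linarith)

theorem integral_mul_log_pow {m : ℕ} (hm : 0 < m) :
    ∫ x in Ioi (0 : ℝ), x * Real.log (x ^ (3 * m) + 1) / (x ^ 3 + 1) =
      Real.pi ^ 2 * m / 9 + Real.pi * Real.sqrt 3 / 3 *
        ∑ k ∈ Finset.range m, Real.log (1 + 2 * Real.cos (rootAngle m k)) := by
  rw [setIntegral_congr_fun measurableSet_Ioi fun x hx => integrand_eq_sum hm hx,
    integral_finsetSum]
  · rw [Finset.sum_congr rfl fun k hk => integral_mul_log_norm
      (rootAngle_mem (Finset.mem_range.1 hk)).1 (rootAngle_mem (Finset.mem_range.1 hk)).2]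
    rw [Finset.sum_add_distrib, ← Finset.mul_sum, Finset.sum_const, Finset.card_range, nsmul_eq_mul]
    ring
  · intro k hk
    obtain ⟨h1, h2⟩ := rootAngle_mem (Finset.mem_range.1 hk)
    exact integrableOn_mul_log_norm (by linarith) (by linarith)

/-! ### Closed form of the summands and pairing of roots -/

/-- Put `rootAngle m k` = 2u. Then φ_k + 1 = 2 sin²(3u), and the hypothesis places 3u in (0, π/2),
so the arcsine returns 3u; conclude by sin 3u = sin u (1 + 2 cos 2u). -/
theorem summand_eq {m k : ℕ} (h : 2 * k + 1 < m) :
    summand m k = Real.log 2 + 3 * Real.log (1 + 2 * Real.cos (rootAngle m k)) := by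
  have hπ := Real.pi_pos
  have hm : (0 : ℝ) < m := by exact_mod_cast (Nat.zero_le _).trans_lt h
  have h' : 2 * (k : ℝ) + 1 < m := by exact_mod_cast h
  set θ : ℝ := (2 * (k : ℝ) + 1) * Real.pi / m with hθ
  have hθ0 : 0 < θ := by positivity
  have hθπ : θ < Real.pi := by
    rw [hθ, div_lt_iff₀ hm]
    nlinarith
  obtain ⟨u, hu⟩ : ∃ u, u = (Real.pi - θ) / 6 := ⟨_, rfl⟩
  have hangle : rootAngle m k = 2 * u := by rw [rootAngle, hu]; ring
  have hφ : phi m k + 1 = 2 * Real.sin (3 * u) ^ 2 := by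
    have e : 3 * u = Real.pi / 2 - θ / 2 := by rw [hu]; ring
    rw [phi, ← hθ, e, Real.sin_pi_div_two_sub, Real.cos_sq]
    ring_nf
  have hs3 : 0 < Real.sin (3 * u) := Real.sin_pos_of_pos_of_lt_pi (by linarith) (by linarith)
  have hs : 0 < Real.sin u := Real.sin_pos_of_pos_of_lt_pi (by linarith) (by linarith)
  have hc : 0 < 1 + 2 * Real.cos (2 * u) := by
    have := Real.cos_pos_of_mem_Ioo (x := 2 * u) ⟨by linarith, by linarith⟩
    linarith
  have harc : Real.arcsin (Real.sqrt ((phi m k + 1) / 2)) = 3 * u := by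
    rw [hφ, mul_div_cancel_left₀ _ two_ne_zero, Real.sqrt_sq hs3.le,
      Real.arcsin_sin (by linarith) (by linarith)]
  have htriple : Real.sin (3 * u) = Real.sin u * (1 + 2 * Real.cos (2 * u)) := by
    rw [Real.sin_three_mul, Real.cos_two_mul]
    linear_combination -4 * Real.sin u * Real.sin_sq_add_cos_sq u
  rw [summand, harc, hφ, hangle, show 1 / 3 * (3 * u) = u by ring,
    show 2 / 3 * (3 * u) = 2 * u by ring, htriple, Real.log_mul (by norm_num) (by positivity),
    Real.log_pow, Real.log_mul hs.ne' hc.ne', add_comm (2 * Real.cos (2 * u)) 1]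
  push_cast
  ring

theorem sum_summand {m n : ℕ} (h : 2 * n ≤ m) :
    ∑ k ∈ Finset.range n, summand m k = n * Real.log 2 +
      3 * ∑ k ∈ Finset.range n, Real.log (1 + 2 * Real.cos (rootAngle m k)) := by
  have : ∀ k ∈ Finset.range n, summand m k =
      Real.log 2 + 3 * Real.log (1 + 2 * Real.cos (rootAngle m k)) := fun k hk =>
    summand_eq (by have := Finset.mem_range.1 hk; omega)
  rw [Finset.sum_congr rfl this, Finset.sum_add_distrib, ← Finset.mul_sum, Finset.sum_const,
    Finset.card_range, nsmul_eq_mul]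

theorem sum_log_rootAngle_even (n : ℕ) :
    ∑ k ∈ Finset.range (n + n), Real.log (1 + 2 * Real.cos (rootAngle (n + n) k)) =
      2 * ∑ k ∈ Finset.range n, Real.log (1 + 2 * Real.cos (rootAngle (n + n) k)) := by
  rw [Finset.sum_range_add, two_mul]
  congr 1
  rw [← Finset.sum_range_reflect]
  refine Finset.sum_congr rfl fun k hk => ?_
  have := Finset.mem_range.1 hk
  rw [rootAngle_reflect (j := n + (n - 1 - k)) (k := k) (by omega), Real.cos_neg]

/-- The unpaired middle index is the real root y = -1: its angle is 0, and log(1 + 2 cos 0) = log 3.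
-/
theorem sum_log_rootAngle_odd (n : ℕ) :
    ∑ k ∈ Finset.range (2 * n + 1), Real.log (1 + 2 * Real.cos (rootAngle (2 * n + 1) k)) =
      2 * ∑ k ∈ Finset.range n, Real.log (1 + 2 * Real.cos (rootAngle (2 * n + 1) k)) +
        Real.log 3 := by
  have hmid : rootAngle (2 * n + 1) n = 0 := by
    have := rootAngle_reflect (m := 2 * n + 1) (j := n) (k := n) (by omega)
    linarith
  have hrefl : ∑ k ∈ Finset.range n,
        Real.log (1 + 2 * Real.cos (rootAngle (2 * n + 1) (n + (k + 1)))) =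
      ∑ k ∈ Finset.range n, Real.log (1 + 2 * Real.cos (rootAngle (2 * n + 1) k)) := by
    rw [← Finset.sum_range_reflect]
    refine Finset.sum_congr rfl fun k hk => ?_
    have := Finset.mem_range.1 hk
    rw [rootAngle_reflect (j := n + (n - 1 - k + 1)) (k := k) (by omega), Real.cos_neg]
  conv_lhs => rw [show Finset.range (2 * n + 1) = Finset.range (n + (n + 1)) by congr 1; omega]
  rw [Finset.sum_range_add, Finset.sum_range_succ', hrefl, add_zero, hmid, Real.cos_zero]
  norm_num
  ring

end

theorem theorem2p11 :
    (∀ m : ℕ, 2 ≤ m → Even m →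
      MeasureTheory.IntegrableOn
        (fun x : ℝ => x * Real.log (x ^ (3 * m) + 1) / (x ^ 3 + 1)) (Set.Ioi 0) ∧
      ∫ x in Set.Ioi (0 : ℝ), x * Real.log (x ^ (3 * m) + 1) / (x ^ 3 + 1) =
        Real.pi ^ 2 * (m : ℝ) / 9
          - Real.pi * (m : ℝ) * Real.sqrt 3 / 9 * Real.log 2
          + 2 * Real.pi * Real.sqrt 3 / 9
            * ∑ k ∈ Finset.range (m / 2), summand m k) ∧
    (∀ m : ℕ, 1 ≤ m → Odd m →
      MeasureTheory.IntegrableOn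
        (fun x : ℝ => x * Real.log (x ^ (3 * m) + 1) / (x ^ 3 + 1)) (Set.Ioi 0) ∧
      ∫ x in Set.Ioi (0 : ℝ), x * Real.log (x ^ (3 * m) + 1) / (x ^ 3 + 1) =
        Real.pi ^ 2 * (m : ℝ) / 9
          + Real.pi * Real.sqrt 3 / 3 * Real.log 3
          - Real.pi * ((m : ℝ) - 1) * Real.sqrt 3 / 9 * Real.log 2
          + 2 * Real.pi * Real.sqrt 3 / 9
            * ∑ k ∈ Finset.range ((m - 1) / 2), summand m k) := by
  refine ⟨fun m hm he => ⟨integrableOn_mul_log_pow (by omega), ?_⟩,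
    fun m hm ho => ⟨integrableOn_mul_log_pow (by omega), ?_⟩⟩
  · obtain ⟨n, rfl⟩ := he
    rw [integral_mul_log_pow (by omega), show (n + n) / 2 = n by omega,
      sum_summand (by omega), sum_log_rootAngle_even]
    push_cast
    ring
  · obtain ⟨n, rfl⟩ := ho
    rw [integral_mul_log_pow (by omega), show (2 * n + 1 - 1) / 2 = n by omega,
      sum_summand (by omega), sum_log_rootAngle_odd]
    push_cast
    ring
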